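/- Let $\mathcal{E}$ be an exact category in the sense of Quillen: an additive category with an isomorphism-closed class of kernel-cokernel pairs $0\to X\xrightarrow{i}Y\xrightarrow{d}Z\to 0$, called conflations, such that inflations (the maps $i$ that occur) and deflations (the maps $d$ that occur) contain the identities, are closed under composition, and inflations have pushouts, and deflations have pullbacks, along arbitrary morphisms, which are again inflations, respectively deflations. A weak factorization system is a pair $(\mathcal{L},\mathcal{R})$ of classes of morphisms of $\mathcal{E}$, both closed under retracts, such that every $f\in\mathcal{L}$ has the left lifting property for every $g\in\mathcal{R}$ and every morphism $h$ factors as $h=gf$ with $f\in\mathcal{L}$ and $g\in\mathcal{R}$. It is functorial if the factorization can be chosen functorially in $h$. It is exact if, for every morphism $f$: $f\in\mathcal{L}$ if and only if $f$ is an inflation and $0\to\operatorname{Coker}f$ is in $\mathcal{L}$; and $f\in\mathcal{R}$ if and only if $f$ is a deflation and $\operatorname{Ker}f\to0$ is in $\mathcal{R}$. A complete cotorsion pair is a pair $(\mathcal{A},\mathcal{B})$ of classes of objects such that $\mathcal{A}=\{A\mid\operatorname{Ext}^1_{\mathcal{E}}(A,B)=0\ \forall B\in\mathcal{B}\}$ and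 $\mathcal{B}=\{B\mid\operatorname{Ext}^1_{\mathcal{E}}(A,B)=0\ \forall A\in\mathcal{A}\}$ (Yoneda's $\operatorname{Ext}^1$), and such that every object $X$ admits conflations $0\to X\to B_X\to A_X\to0$ and $0\to B^X\to A^X\to X\to0$ with $A_X,A^X\in\mathcal{A}$ and $B_X,B^X\in\mathcal{B}$. It is functorially complete if these conflations can be chosen functorially in $X$. Let $\operatorname{Coker}\mathcal{L}$ be the class of objects isomorphic to $\operatorname{Coker}f$ for some inflation $f\in\mathcal{L}$, and $\operatorname{Ker}\mathcal{R}$ the class of objects isomorphic to $\operatorname{Ker}f$ for some deflation $f\in\mathcal{R}$. Let $\operatorname{Infl}\mathcal{A}$ be the class of inflations with cokernel in $\mathcal{A}$, and $\operatorname{Defl}\mathcal{B}$ the class of deflations with kernel in $\mathcal{B}$. Put $\Phi(\mathcal{L},\mathcal{R})=(\operatorname{Coker}\mathcal{L},\operatorname{Ker}\mathcal{R})$ and $\Psi(\mathcal{A},\mathcal{B})=(\operatorname{Infl}\mathcal{A},\operatorname{Defl}\mathcal{B})$. Then: 1. $\Phi$ sends exact weak factorization systems to complete cotorsion pairs, and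 exact functorial weak factorization systems to functorially complete cotorsion pairs. Moreover $\Psi(\Phi(\mathcal{L},\mathcal{R}))=(\mathcal{L},\mathcal{R})$ for every exact weak factorization system $(\mathcal{L},\mathcal{R})$, and $\Phi(\Psi(\mathcal{A},\mathcal{B}))=(\mathcal{A},\mathcal{B})$ for every complete cotorsion pair $(\mathcal{A},\mathcal{B})$. 2. If $\mathcal{E}$ is weakly idempotent complete (every section, that is, every split monomorphism, has a cokernel), then $\Phi$ and $\Psi$ are mutually inverse bijections between the exact weak factorization systems and the complete cotorsion pairs, and they restrict to mutually inverse bijections between the exact functorial weak factorization systems and the functorially complete cotorsion pairs. -/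

import Mathlib

open CategoryTheory CategoryTheory.Limits
open scoped ZeroObject

universe v u

namespace QuillenExact

section Axioms

variable {C : Type u} [Category.{v} C] [Preadditive C]

/-- The morphisms `i` that occur as the first map of a sequence `X ⟶ Y ⟶ Z` in the class `P`. -/
def firstMaps (P : ObjectProperty (ShortComplex C)) : MorphismProperty C :=
  fun _ Y i => ∃ (Z : C) (d : Y ⟶ Z) (w : i ≫ d = 0), P (ShortComplex.mk i d w)

/-- The morphisms `d` that occur as the second map of a sequence `X ⟶ Y ⟶ Z` in the class `P`. -/
def secondMaps (P : ObjectProperty (ShortComplex C)) : MorphismProperty C :=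
  fun Y _ d => ∃ (X : C) (i : X ⟶ Y) (w : i ≫ d = 0), P (ShortComplex.mk i d w)

end Axioms

/-- A (Quillen) exact structure on an additive category: an isomorphism-closed class of
kernel-cokernel pairs, the conflations, such that inflations (first maps of conflations) and
deflations (second maps of conflations) contain identities, are closed under composition, and are
stable under pushouts respectively pullbacks, which are required to exist. -/
structure ExactStructure (C : Type u) [Category.{v} C] [Preadditive C]
    [HasFiniteBiproducts C] where
  /-- the class of conflations -/
  conflation : ObjectProperty (ShortComplex C)
  conflation_of_iso : ∀ {S T : ShortComplex C}, (S ≅ T) → conflation S → conflation T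
  isKernel : ∀ {S : ShortComplex C}, conflation S → Nonempty (IsLimit (KernelFork.ofι S.f S.zero))
  isCokernel : ∀ {S : ShortComplex C}, conflation S →
    Nonempty (IsColimit (CokernelCofork.ofπ S.g S.zero))
  id_inflation : ∀ X : C, firstMaps conflation (𝟙 X)
  id_deflation : ∀ X : C, secondMaps conflation (𝟙 X)
  comp_inflation : ∀ {X Y Z : C} (f : X ⟶ Y) (g : Y ⟶ Z),
    firstMaps conflation f → firstMaps conflation g → firstMaps conflation (f ≫ g)
  comp_deflation : ∀ {X Y Z : C} (f : X ⟶ Y) (g : Y ⟶ Z),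
    secondMaps conflation f → secondMaps conflation g → secondMaps conflation (f ≫ g)
  pushout_inflation : ∀ {X Y X' : C} (f : X ⟶ Y) (a : X ⟶ X'), firstMaps conflation f →
    ∃ (Y' : C) (b : Y ⟶ Y') (f' : X' ⟶ Y'), IsPushout f a b f' ∧ firstMaps conflation f'
  pullback_deflation : ∀ {Y Z Z' : C} (g : Y ⟶ Z) (c : Z' ⟶ Z), secondMaps conflation g →
    ∃ (Y' : C) (b : Y' ⟶ Y) (g' : Y' ⟶ Z'), IsPullback b g' g c ∧ secondMaps conflation g'

/-- A category (with zero morphisms) is weakly idempotent complete if every section has a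
cokernel. -/
def IsWeaklyIdempotentComplete (C : Type u) [Category.{v} C] [HasZeroMorphisms C] : Prop :=
  ∀ {X Y : C} (s : X ⟶ Y), IsSplitMono s → HasCokernel s

section WeakFactorization

variable {C : Type u} [Category.{v} C]

/-- Weak factorization systems. -/
structure IsWFS (L R : MorphismProperty C) : Prop where
  retract_left : L.IsStableUnderRetracts
  retract_right : R.IsStableUnderRetracts
  lifting : ∀ {A B X Y : C} (f : A ⟶ B) (g : X ⟶ Y), L f → R g → HasLiftingProperty f g
  factorization : L.HasFactorization R

/-- This notion of weak factorization system agrees with the one in Mathlib. -/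
theorem isWFS_iff (L R : MorphismProperty C) :
    IsWFS L R ↔ MorphismProperty.IsWeakFactorizationSystem L R := by
  constructor
  · rintro ⟨h1, h2, h3, h4⟩
    exact .mk' L R h3
  · intro h
    exact ⟨h.llp ▸ inferInstance, h.rlp ▸ inferInstance,
      fun f g hf hg => MorphismProperty.hasLiftingProperty_of_wfs f g hf hg, h.hasFactorization⟩

end WeakFactorization

namespace ExactStructure

variable {C : Type u} [Category.{v} C] [Preadditive C] [HasFiniteBiproducts C]
variable (E : ExactStructure C)

/-- The class of inflations. -/
def inflation : MorphismProperty C := firstMaps E.conflation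

/-- The class of deflations. -/
def deflation : MorphismProperty C := secondMaps E.conflation

/-- A conflation `0 ⟶ Y ⟶ M ⟶ X ⟶ 0`, regarded as an extension of `X` by `Y`. -/
structure Extension (X Y : C) where
  /-- the middle term -/
  M : C
  /-- the inflation -/
  i : Y ⟶ M
  /-- the deflation -/
  d : M ⟶ X
  w : i ≫ d = 0
  conflation : E.conflation (ShortComplex.mk i d w)

/-- There is a morphism of extensions that is the identity on both end terms. -/
def Extension.Rel {X Y : C} (ε ε' : E.Extension X Y) : Prop :=
  ∃ φ : ε.M ⟶ ε'.M, ε.i ≫ φ = ε'.i ∧ φ ≫ ε'.d = ε.d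

/-- Yoneda's `Ext¹(X, Y)`: extensions of `X` by `Y` modulo the equivalence relation generated
by morphisms of extensions which are the identity on both end terms. -/
def Ext1 (X Y : C) : Type max u v := Quot (Extension.Rel E (X := X) (Y := Y))

/-- `Ext¹(X, Y) = 0`: the (never empty) collection `Ext¹(X, Y)` has exactly one element. -/
def Ext1Vanishes (X Y : C) : Prop := Subsingleton (E.Ext1 X Y)

/-- The right orthogonal class `S^⊥` with respect to `Ext¹`. -/
def rightPerp (S : ObjectProperty C) : ObjectProperty C :=
  fun B => ∀ A : C, S A → E.Ext1Vanishes A B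

/-- The left orthogonal class `^⊥S` with respect to `Ext¹`. -/
def leftPerp (S : ObjectProperty C) : ObjectProperty C :=
  fun A => ∀ B : C, S B → E.Ext1Vanishes A B

/-- Complete cotorsion pairs. -/
structure IsCompleteCotorsionPair (A B : ObjectProperty C) : Prop where
  left_eq : A = E.leftPerp B
  right_eq : E.rightPerp A = B
  approx_right : ∀ X : C, ∃ (BX AX : C) (i : X ⟶ BX) (d : BX ⟶ AX) (w : i ≫ d = 0),
    E.conflation (ShortComplex.mk i d w) ∧ A AX ∧ B BX
  approx_left : ∀ X : C, ∃ (BX AX : C) (i : BX ⟶ AX) (d : AX ⟶ X) (w : i ≫ d = 0),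
    E.conflation (ShortComplex.mk i d w) ∧ A AX ∧ B BX

/-- Complete cotorsion pairs whose approximation sequences, of both kinds, can be chosen
functorially. -/
structure IsFunctoriallyCompleteCotorsionPair (A B : ObjectProperty C) : Prop
    extends E.IsCompleteCotorsionPair A B where
  functorial_right : ∃ (FB FA : C ⥤ C) (i : 𝟭 C ⟶ FB) (d : FB ⟶ FA)
    (w : ∀ X : C, i.app X ≫ d.app X = 0), ∀ X : C,
      E.conflation (ShortComplex.mk (i.app X) (d.app X) (w X)) ∧ A (FA.obj X) ∧ B (FB.obj X)
  functorial_left : ∃ (FB FA : C ⥤ C) (i : FB ⟶ FA) (d : FA ⟶ 𝟭 C)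
    (w : ∀ X : C, i.app X ≫ d.app X = 0), ∀ X : C,
      E.conflation (ShortComplex.mk (i.app X) (d.app X) (w X)) ∧ A (FA.obj X) ∧ B (FB.obj X)

/-- Exact weak factorization systems: `f ∈ L` iff `f` is an inflation and `0 ⟶ Coker f` is in `L`,
and `f ∈ R` iff `f` is a deflation and `Ker f ⟶ 0` is in `R`. -/
structure IsExactWFS (L R : MorphismProperty C) : Prop extends IsWFS L R where
  left_iff : ∀ {X Y : C} (f : X ⟶ Y), L f ↔
    ∃ (Z : C) (d : Y ⟶ Z) (w : f ≫ d = 0),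
      E.conflation (ShortComplex.mk f d w) ∧ L (0 : (0 : C) ⟶ Z)
  right_iff : ∀ {Y Z : C} (f : Y ⟶ Z), R f ↔
    ∃ (X : C) (i : X ⟶ Y) (w : i ≫ f = 0),
      E.conflation (ShortComplex.mk i f w) ∧ R (0 : X ⟶ (0 : C))

/-- Exact functorial weak factorization systems. -/
structure IsExactFunctorialWFS (L R : MorphismProperty C) : Prop extends E.IsExactWFS L R where
  functorial : L.HasFunctorialFactorization R

/-- `Coker L`: the objects isomorphic to the cokernel of some inflation in `L`. -/
def cokerClass (L : MorphismProperty C) : ObjectProperty C :=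
  fun A => ∃ (X Y Z : C) (f : X ⟶ Y) (d : Y ⟶ Z) (w : f ≫ d = 0),
    L f ∧ E.conflation (ShortComplex.mk f d w) ∧ Nonempty (A ≅ Z)

/-- `Ker R`: the objects isomorphic to the kernel of some deflation in `R`. -/
def kerClass (R : MorphismProperty C) : ObjectProperty C :=
  fun B => ∃ (X Y Z : C) (i : X ⟶ Y) (f : Y ⟶ Z) (w : i ≫ f = 0),
    R f ∧ E.conflation (ShortComplex.mk i f w) ∧ Nonempty (B ≅ X)

/-- `Infl A`: the inflations with cokernel in `A`. -/
def inflClass (A : ObjectProperty C) : MorphismProperty C :=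
  fun _ Y f => ∃ (Z : C) (d : Y ⟶ Z) (w : f ≫ d = 0), E.conflation (ShortComplex.mk f d w) ∧ A Z

/-- `Defl B`: the deflations with kernel in `B`. -/
def deflClass (B : ObjectProperty C) : MorphismProperty C :=
  fun Y _ f => ∃ (X : C) (i : X ⟶ Y) (w : i ≫ f = 0), E.conflation (ShortComplex.mk i f w) ∧ B X

/-- The assignment `(L, R) ↦ (Coker L, Ker R)`. -/
def cokerKer (p : MorphismProperty C × MorphismProperty C) :
    ObjectProperty C × ObjectProperty C :=
  (E.cokerClass p.1, E.kerClass p.2)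

/-- The assignment `(A, B) ↦ (Infl A, Defl B)`. -/
def inflDefl (p : ObjectProperty C × ObjectProperty C) :
    MorphismProperty C × MorphismProperty C :=
  (E.inflClass p.1, E.deflClass p.2)

/-- All exact weak factorization systems. -/
def exactWFS : Set (MorphismProperty C × MorphismProperty C) :=
  {p | E.IsExactWFS p.1 p.2}

/-- All exact functorial weak factorization systems. -/
def exactFunctorialWFS : Set (MorphismProperty C × MorphismProperty C) :=
  {p | E.IsExactFunctorialWFS p.1 p.2}

/-- All complete cotorsion pairs. -/
def completeCotorsionPairs : Set (ObjectProperty C × ObjectProperty C) :=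
  {p | E.IsCompleteCotorsionPair p.1 p.2}

/-- All functorially complete cotorsion pairs. -/
def functoriallyCompleteCotorsionPairs : Set (ObjectProperty C × ObjectProperty C) :=
  {p | E.IsFunctoriallyCompleteCotorsionPair p.1 p.2}

end ExactStructure

end QuillenExact

/-!
If `f` is an inflation with cokernel `A` and `g` a deflation with kernel `B`, the obstruction to
lifting `f` against `g` lies in `Ext¹(A, B)`; conversely, lifting `0 ⟶ A` against all deflations
with kernel `B` splits every extension of `A` by `B`. Hence `Infl (^⊥S)` is the class of inflations
with the left lifting property against `Defl S`, and dually, so orthogonality of classes of objects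
translates into orthogonality of classes of morphisms. The approximation sequences of `X` are the
factorizations of `X ⟶ 0` and `0 ⟶ X`.

For the converse, let `f : X ⟶ Y` and choose a conflation `B₁ ⟶ A₁ ⟶ Y`. Then `f` is
`X ⟶ X ⊞ A₁ ⟶ Y`, an inflation with cokernel `A₁` followed by a deflation. Replacing the kernel
`K` of the latter by `B₂` through a pushout along `K ⟶ B₂ ⟶ A₂` gives
`X ⟶ X ⊞ A₁ ⟶ Q ⟶ Y`, where the last map has kernel `B₂`. The functorial version is the same
argument for `Arrow.leftToRight` in the pointwise exact structure on the functors
`Arrow C ⥤ C`. Weak idempotent completeness is what makes inflations and deflations stable under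
retracts.
-/

namespace QuillenExact

section Opposite

variable {C : Type u} [Category.{v} C] [Preadditive C]

lemma firstMaps_unop_iff (P : ObjectProperty (ShortComplex C)) {X Y : Cᵒᵖ} (f : X ⟶ Y) :
    firstMaps (fun S => P S.unop) f ↔ secondMaps P f.unop :=
  ⟨fun ⟨Z, d, w, h⟩ => ⟨Z.unop, d.unop, congrArg Quiver.Hom.unop w, h⟩,
    fun ⟨Z, d, w, h⟩ => ⟨.op Z, d.op, congrArg Quiver.Hom.op w, h⟩⟩

lemma secondMaps_unop_iff (P : ObjectProperty (ShortComplex C)) {X Y : Cᵒᵖ} (f : X ⟶ Y) :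
    secondMaps (fun S => P S.unop) f ↔ firstMaps P f.unop :=
  ⟨fun ⟨Z, d, w, h⟩ => ⟨Z.unop, d.unop, congrArg Quiver.Hom.unop w, h⟩,
    fun ⟨Z, d, w, h⟩ => ⟨.op Z, d.op, congrArg Quiver.Hom.op w, h⟩⟩

instance [HasFiniteBiproducts C] : HasFiniteBiproducts Cᵒᵖ := .of_hasFiniteProducts

end Opposite

section Pointwise

variable {C : Type u} [Category.{v} C] {D : Type*} [Category* D] {F G H : D ⥤ C}

lemma exists_isPushout_app (f : F ⟶ G) (a : F ⟶ H) [∀ X, HasPushout (f.app X) (a.app X)] :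
    ∃ (Q : D ⥤ C) (b : G ⟶ Q) (g : H ⟶ Q), IsPushout f a b g ∧
      ∀ X, IsPushout (f.app X) (a.app X) (b.app X) (g.app X) := by
  have (X : D) : HasColimit ((span f a).flip.obj X) :=
    hasColimit_of_iso (F := span (f.app X) (a.app X)) (diagramIsoSpan _)
  have sq := IsPushout.of_hasPushout f a
  exact ⟨_, _, _, sq, fun X => sq.map ((evaluation D C).obj X)⟩

lemma exists_isPullback_app (f : F ⟶ H) (a : G ⟶ H) [∀ X, HasPullback (f.app X) (a.app X)] :
    ∃ (Q : D ⥤ C) (b : Q ⟶ F) (g : Q ⟶ G), IsPullback b g f a ∧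
      ∀ X, IsPullback (b.app X) (g.app X) (f.app X) (a.app X) := by
  have (X : D) : HasLimit ((cospan f a).flip.obj X) :=
    hasLimit_of_iso (F := cospan (f.app X) (a.app X))
      (diagramIsoCospan ((cospan f a).flip.obj X)).symm
  have sq := IsPullback.of_hasPullback f a
  exact ⟨_, _, _, sq, fun X => sq.map ((evaluation D C).obj X)⟩

end Pointwise

namespace IsWeaklyIdempotentComplete

variable {C : Type u} [Category.{v} C] [Preadditive C]

lemma hasKernel (hC : IsWeaklyIdempotentComplete C) {X Y : C} {r : X ⟶ Y} {s : Y ⟶ X}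
    (hs : s ≫ r = 𝟙 Y) : HasKernel r := by
  have := hC s ⟨⟨r, hs⟩⟩
  let t : cokernel s ⟶ X := cokernel.desc s (𝟙 X - r ≫ s) (by simp [reassoc_of% hs])
  have ht : cokernel.π s ≫ t = 𝟙 X - r ≫ s := cokernel.π_desc _ _ _
  have htr : t ≫ r = 0 := by simp [← cancel_epi (cokernel.π s), reassoc_of% ht, hs]
  have htπ : t ≫ cokernel.π s = 𝟙 _ := by simp [← cancel_epi (cokernel.π s), reassoc_of% ht]
  exact ⟨_, KernelFork.IsLimit.ofι t htr (fun k _ => k ≫ cokernel.π s)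
    (fun k hk => by simp [ht, reassoc_of% hk]) (fun k _ m hm => by simp [← hm, htπ])⟩

lemma op (hC : IsWeaklyIdempotentComplete C) : IsWeaklyIdempotentComplete Cᵒᵖ := by
  intro X Y s hs
  have := hC.hasKernel (r := s.unop) (congrArg Quiver.Hom.unop (IsSplitMono.id s))
  exact ⟨_, KernelFork.IsLimit.ofιOp _ (kernel.condition s.unop) (kernelIsKernel s.unop)⟩

end IsWeaklyIdempotentComplete

namespace ExactStructure

variable {C : Type u} [Category.{v} C] [Preadditive C] [HasFiniteBiproducts C]

attribute [local instance] hasBinaryBiproducts_of_finite_biproducts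

/-- `X ⟶ Y ⟶ Z` is a conflation. Unlike membership of a `ShortComplex` in `E.conflation`, this
predicate can be stated before the composite is known to vanish. -/
def IsConflation (E : ExactStructure C) {X Y Z : C} (i : X ⟶ Y) (d : Y ⟶ Z) : Prop :=
  ∃ w : i ≫ d = 0, E.conflation (.mk i d w)

variable {E : ExactStructure C}

namespace IsConflation

variable {X Y Z : C} {i : X ⟶ Y} {d : Y ⟶ Z}

lemma w (h : E.IsConflation i d) : i ≫ d = 0 := h.choose

lemma conflation (h : E.IsConflation i d) : E.conflation (.mk i d h.w) := h.choose_spec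

lemma isLimit (h : E.IsConflation i d) : Nonempty (IsLimit (KernelFork.ofι i h.w)) :=
  E.isKernel h.conflation

lemma isColimit (h : E.IsConflation i d) : Nonempty (IsColimit (CokernelCofork.ofπ d h.w)) :=
  E.isCokernel h.conflation

lemma mono (h : E.IsConflation i d) : Mono i :=
  h.isLimit.elim mono_of_isLimit_fork

lemma epi (h : E.IsConflation i d) : Epi d :=
  h.isColimit.elim epi_of_isColimit_cofork

lemma exists_lift (h : E.IsConflation i d) {T : C} (k : T ⟶ Y) (hk : k ≫ d = 0) :
    ∃ l : T ⟶ X, l ≫ i = k :=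
  h.isLimit.elim fun hl => ⟨_, (KernelFork.IsLimit.lift' hl k hk).2⟩

lemma exists_desc (h : E.IsConflation i d) {T : C} (k : Y ⟶ T) (hk : i ≫ k = 0) :
    ∃ l : Z ⟶ T, d ≫ l = k :=
  h.isColimit.elim fun hl => ⟨_, (CokernelCofork.IsColimit.desc' hl k hk).2⟩

lemma inflation (h : E.IsConflation i d) : E.inflation i := ⟨Z, d, h⟩

lemma deflation (h : E.IsConflation i d) : E.deflation d := ⟨X, i, h⟩

lemma of_iso (h : E.IsConflation i d) {X' Y' Z' : C} {i' : X' ⟶ Y'} {d' : Y' ⟶ Z'}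
    (a : X ≅ X') (b : Y ≅ Y') (c : Z ≅ Z') (hi : a.hom ≫ i' = i ≫ b.hom)
    (hd : b.hom ≫ d' = d ≫ c.hom) : E.IsConflation i' d' := by
  have w' : i' ≫ d' = 0 := by
    rw [← cancel_epi a.hom, reassoc_of% hi, hd, reassoc_of% h.w, zero_comp, comp_zero]
  exact ⟨w', E.conflation_of_iso (ShortComplex.isoMk a b c hi hd) h.conflation⟩

end IsConflation

lemma inflation_iff {X Y : C} {i : X ⟶ Y} :
    E.inflation i ↔ ∃ (Z : C) (d : Y ⟶ Z), E.IsConflation i d := .rfl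

lemma deflation_iff {Y Z : C} {d : Y ⟶ Z} :
    E.deflation d ↔ ∃ (X : C) (i : X ⟶ Y), E.IsConflation i d := .rfl

lemma IsConflation.of_isColimit {X Y Z : C} {i : X ⟶ Y} {d : Y ⟶ Z} {w : i ≫ d = 0}
    (hi : E.inflation i) (hd : IsColimit (CokernelCofork.ofπ d w)) : E.IsConflation i d := by
  obtain ⟨Z', d', h⟩ := inflation_iff.1 hi
  obtain ⟨hd'⟩ := h.isColimit
  exact h.of_iso (Iso.refl _) (Iso.refl _) (hd'.coconePointUniqueUpToIso hd) (by simp)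
    (by simpa using (hd'.comp_coconePointUniqueUpToIso_hom hd .one).symm)

section Opposite

variable (E)

/-- The opposite exact structure, in which inflations and deflations are exchanged. -/
def op : ExactStructure Cᵒᵖ where
  conflation S := E.conflation S.unop
  conflation_of_iso e h := E.conflation_of_iso ((ShortComplex.unopFunctor C).mapIso e).unop.symm h
  isKernel h := (E.isCokernel h).map (CokernelCofork.IsColimit.ofπOp _ _)
  isCokernel h := (E.isKernel h).map (KernelFork.IsLimit.ofιOp _ _)
  id_inflation X := (firstMaps_unop_iff _ _).2 (E.id_deflation X.unop)
  id_deflation X := (secondMaps_unop_iff _ _).2 (E.id_inflation X.unop)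
  comp_inflation f g hf hg := (firstMaps_unop_iff _ _).2 <|
    E.comp_deflation _ _ ((firstMaps_unop_iff _ g).1 hg) ((firstMaps_unop_iff _ f).1 hf)
  comp_deflation f g hf hg := (secondMaps_unop_iff _ _).2 <|
    E.comp_inflation _ _ ((secondMaps_unop_iff _ g).1 hg) ((secondMaps_unop_iff _ f).1 hf)
  pushout_inflation f a hf := by
    obtain ⟨Y, b, f', sq, hf'⟩ :=
      E.pullback_deflation f.unop a.unop ((firstMaps_unop_iff _ f).1 hf)
    exact ⟨.op Y, b.op, f'.op, sq.flip.op, (firstMaps_unop_iff _ f'.op).2 hf'⟩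
  pullback_deflation g c hg := by
    obtain ⟨Y, b, g', sq, hg'⟩ :=
      E.pushout_inflation g.unop c.unop ((secondMaps_unop_iff _ g).1 hg)
    exact ⟨.op Y, b.op, g'.op, sq.flip.op, (secondMaps_unop_iff _ g'.op).2 hg'⟩

lemma op_inflation : E.op.inflation = E.deflation.op := by
  ext X Y f
  exact firstMaps_unop_iff _ f

variable {E}

lemma IsConflation.op {X Y Z : C} {i : X ⟶ Y} {d : Y ⟶ Z} (h : E.IsConflation i d) :
    E.op.IsConflation d.op i.op :=
  ⟨congrArg Quiver.Hom.op h.w, h.conflation⟩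

lemma IsConflation.unop {X Y Z : Cᵒᵖ} {i : X ⟶ Y} {d : Y ⟶ Z} (h : E.op.IsConflation i d) :
    E.IsConflation d.unop i.unop :=
  ⟨congrArg Quiver.Hom.unop h.w, h.conflation⟩

lemma IsConflation.of_isLimit {X Y Z : C} {i : X ⟶ Y} {d : Y ⟶ Z} {w : i ≫ d = 0}
    (hd : E.deflation d) (hi : IsLimit (KernelFork.ofι i w)) : E.IsConflation i d :=
  (IsConflation.of_isColimit (E := E.op) (w := congrArg Quiver.Hom.op w)
    ((firstMaps_unop_iff _ d.op).2 hd) (KernelFork.IsLimit.ofιOp i w hi)).unop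

end Opposite

section Stability

variable (E)

instance : E.inflation.IsMultiplicative where
  id_mem := E.id_inflation
  comp_mem := E.comp_inflation

instance : E.deflation.IsMultiplicative where
  id_mem := E.id_deflation
  comp_mem := E.comp_deflation

instance : E.inflation.RespectsIso := by
  refine .mk _ (fun e f hf => ?_) (fun e f hf => ?_)
  · obtain ⟨Z, d, h⟩ := inflation_iff.1 hf
    exact (h.of_iso (d' := d) e.symm (Iso.refl _) (Iso.refl _) (by simp) (by simp)).inflation
  · obtain ⟨Z, d, h⟩ := inflation_iff.1 hf
    exact (h.of_iso (d' := e.inv ≫ d) (Iso.refl _) e (Iso.refl _) (by simp) (by simp)).inflation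

instance : E.inflation.IsStableUnderCobaseChange := .mk' fun A B A' f g _ hf => by
  obtain ⟨B', b, f', sq, hf'⟩ := E.pushout_inflation f g hf
  rw [← sq.inr_isoPushout_hom]
  exact (E.inflation.cancel_right_of_respectsIso _ _).2 hf'

instance : E.deflation.IsStableUnderBaseChange := by
  have : E.deflation.op.IsStableUnderCobaseChange := E.op_inflation ▸ inferInstance
  exact inferInstanceAs E.deflation.op.unop.IsStableUnderBaseChange

variable {E} {X Y Z : C} {i : X ⟶ Y} {d : Y ⟶ Z}

lemma IsConflation.of_isPushout (h : E.IsConflation i d) {X' Y' : C} {a : X ⟶ X'} {b : Y ⟶ Y'}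
    {i' : X' ⟶ Y'} (sq : IsPushout i a b i') {d' : Y' ⟶ Z} (hb : b ≫ d' = d)
    (hi : i' ≫ d' = 0) : E.IsConflation i' d' := by
  have := h.epi
  have : Epi (b ≫ d') := by rwa [hb]
  have : Epi d' := epi_of_epi b d'
  refine .of_isColimit (w := hi) (E.inflation.of_isPushout sq.flip h.inflation)
    (CokernelCofork.IsColimit.ofπ' _ _ fun k hk => Classical.indefiniteDescription _ ?_)
  obtain ⟨l, hl⟩ := h.exists_desc (b ≫ k) (by rw [sq.w_assoc, hk, comp_zero])
  exact ⟨l, sq.hom_ext (by rw [reassoc_of% hb, hl]) (by rw [reassoc_of% hi, zero_comp, hk])⟩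

lemma IsConflation.of_isPullback (h : E.IsConflation i d) {Y' Z' : C} {c : Z' ⟶ Z}
    {b : Y' ⟶ Y} {d' : Y' ⟶ Z'} (sq : IsPullback b d' d c) {i' : X ⟶ Y'} (hb : i' ≫ b = i)
    (hi : i' ≫ d' = 0) : E.IsConflation i' d' :=
  (h.op.of_isPushout sq.flip.op (congrArg Quiver.Hom.op hb) (congrArg Quiver.Hom.op hi)).unop

lemma IsConflation.exists_isPushout (h : E.IsConflation i d) {X' : C} (a : X ⟶ X') :
    ∃ (Y' : C) (b : Y ⟶ Y') (i' : X' ⟶ Y') (d' : Y' ⟶ Z),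
      IsPushout i a b i' ∧ b ≫ d' = d ∧ E.IsConflation i' d' := by
  obtain ⟨Y', b, i', sq, -⟩ := E.pushout_inflation i a h.inflation
  refine ⟨Y', b, i', sq.desc d 0 (by rw [h.w, comp_zero]), sq, by simp, ?_⟩
  exact h.of_isPushout sq (by simp) (by simp)

lemma IsConflation.exists_isPullback (h : E.IsConflation i d) {Z' : C} (c : Z' ⟶ Z) :
    ∃ (Y' : C) (b : Y' ⟶ Y) (d' : Y' ⟶ Z') (i' : X ⟶ Y'),
      IsPullback b d' d c ∧ i' ≫ b = i ∧ E.IsConflation i' d' := by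
  obtain ⟨Y', b, d', sq, -⟩ := E.pullback_deflation d c h.deflation
  refine ⟨Y', b, d', sq.lift i 0 (by rw [h.w, zero_comp]), sq, by simp, ?_⟩
  exact h.of_isPullback sq (by simp) (by simp)

end Stability

section Biproducts

variable (E)

lemma isConflation_zero_id (X : C) : E.IsConflation (0 : (0 : C) ⟶ X) (𝟙 X) := by
  obtain ⟨K, k, h⟩ := deflation_iff.1 (E.id_deflation X)
  have hk : k = 0 := by simpa using h.w
  have := h.mono
  exact h.of_iso (isoZeroOfMonoEqZero hk) (Iso.refl _) (Iso.refl _) (by simp [hk]) (by simp)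

lemma isConflation_id_zero (X : C) : E.IsConflation (𝟙 X) (0 : X ⟶ (0 : C)) :=
  (E.op.isConflation_zero_id (.op X)).unop.of_iso (Iso.refl _) (Iso.refl _)
    (isZero_zero Cᵒᵖ).unop.isoZero (by simp) (by simp)

lemma isConflation_inl_snd (X Y : C) : E.IsConflation (biprod.inl : X ⟶ X ⊞ Y) biprod.snd :=
  (E.isConflation_zero_id Y).of_isPushout (IsPushout.of_has_biproduct X Y).flip biprod.inr_snd
    biprod.inl_snd

lemma deflation_desc {X A Y : C} (f : X ⟶ Y) {a : A ⟶ Y} (ha : E.deflation a) :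
    E.deflation (biprod.desc f a) := by
  have sq : IsPullback (biprod.map (𝟙 X) a) (biprod.snd : X ⊞ A ⟶ A) biprod.snd a :=
    .of_right (by simp [IsPullback.of_has_biproduct]) (by simp) (.of_has_biproduct X Y)
  have h : biprod.desc f a =
      biprod.map (𝟙 X) a ≫ (Biprod.unipotentUpper f).hom ≫ biprod.snd := by ext <;> simp
  rw [h]
  exact E.deflation.comp_mem _ _ (E.deflation.of_isPullback sq.flip ha)
    ((E.deflation.cancel_left_of_respectsIso _ _).2 (E.isConflation_inl_snd X Y).deflation)

end Biproducts

section FunctorCategory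

variable {D : Type*} [Category* D] {F G : D ⥤ C}

instance : HasFiniteBiproducts (D ⥤ C) := .of_hasFiniteProducts

lemma exists_isConflation_app_of_inflation {f : F ⟶ G} (hf : ∀ X, E.inflation (f.app X)) :
    ∃ (H : D ⥤ C) (g : G ⟶ H), ∀ X, E.IsConflation (f.app X) (g.app X) := by
  have (X : D) : HasColimit ((parallelPair f 0).flip.obj X) := by
    obtain ⟨_, _, h⟩ := inflation_iff.1 (hf X)
    obtain ⟨hc⟩ := h.isColimit
    have : HasColimit (parallelPair (f.app X) 0) := ⟨_, hc⟩
    exact hasColimit_of_iso (F := parallelPair (f.app X) 0) (diagramIsoParallelPair _)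
  exact ⟨cokernel f, cokernel.π f, fun X => .of_isColimit (hf X)
    (w := NatTrans.congr_app (cokernel.condition f) X)
    (isColimitOfHasCokernelOfPreservesColimit ((evaluation D C).obj X) f)⟩

lemma exists_isConflation_app_of_deflation {f : F ⟶ G} (hf : ∀ X, E.deflation (f.app X)) :
    ∃ (H : D ⥤ C) (g : H ⟶ F), ∀ X, E.IsConflation (g.app X) (f.app X) := by
  have (X : D) : HasLimit ((parallelPair f 0).flip.obj X) := by
    obtain ⟨_, _, h⟩ := deflation_iff.1 (hf X)
    obtain ⟨hl⟩ := h.isLimit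
    have : HasLimit (parallelPair (f.app X) 0) := ⟨_, hl⟩
    exact hasLimit_of_iso (F := parallelPair (f.app X) 0)
      (diagramIsoParallelPair ((parallelPair f 0).flip.obj X)).symm
  exact ⟨kernel f, kernel.ι f, fun X => .of_isLimit (hf X)
    (w := NatTrans.congr_app (kernel.condition f) X)
    (isLimitOfHasKernelOfPreservesLimit ((evaluation D C).obj X) f)⟩

variable (E D) in
/-- Pointwise conflations of functors. -/
def pointwiseConflation : ObjectProperty (ShortComplex (D ⥤ C)) :=
  fun S => ∀ X, E.conflation (S.map ((evaluation D C).obj X))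

lemma firstMaps_pointwiseConflation_iff {f : F ⟶ G} :
    firstMaps (E.pointwiseConflation D) f ↔ ∀ X, E.inflation (f.app X) := by
  refine ⟨fun ⟨_, _, _, h⟩ X => ⟨_, _, _, h X⟩, fun hf => ?_⟩
  obtain ⟨H, g, h⟩ := exists_isConflation_app_of_inflation hf
  exact ⟨H, g, by ext X; exact (h X).w, fun X => (h X).conflation⟩

lemma secondMaps_pointwiseConflation_iff {f : F ⟶ G} :
    secondMaps (E.pointwiseConflation D) f ↔ ∀ X, E.deflation (f.app X) := by
  refine ⟨fun ⟨_, _, _, h⟩ X => ⟨_, _, _, h X⟩, fun hf => ?_⟩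
  obtain ⟨H, g, h⟩ := exists_isConflation_app_of_deflation hf
  exact ⟨H, g, by ext X; exact (h X).w, fun X => (h X).conflation⟩

variable (E D) in
/-- The pointwise exact structure on a category of functors into an exact category. -/
def functorCategory : ExactStructure (D ⥤ C) where
  conflation := E.pointwiseConflation D
  conflation_of_iso e h X :=
    E.conflation_of_iso (((evaluation D C).obj X).mapShortComplex.mapIso e) (h X)
  isKernel h := ⟨evaluationJointlyReflectsLimits _ fun X =>
    (KernelFork.isLimitMapConeEquiv _ _).symm (E.isKernel (h X)).some⟩
  isCokernel h := ⟨evaluationJointlyReflectsColimits _ fun X =>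
    (CokernelCofork.isColimitMapCoconeEquiv _ _).symm (E.isCokernel (h X)).some⟩
  id_inflation _ := firstMaps_pointwiseConflation_iff.2 fun _ => E.id_inflation _
  id_deflation _ := secondMaps_pointwiseConflation_iff.2 fun _ => E.id_deflation _
  comp_inflation f g := by
    simp only [firstMaps_pointwiseConflation_iff]
    exact fun hf hg X => E.comp_inflation _ _ (hf X) (hg X)
  comp_deflation f g := by
    simp only [secondMaps_pointwiseConflation_iff]
    exact fun hf hg X => E.comp_deflation _ _ (hf X) (hg X)
  pushout_inflation f a := by
    simp only [firstMaps_pointwiseConflation_iff]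
    intro hf
    have (X : D) : HasPushout (f.app X) (a.app X) := by
      obtain ⟨_, _, _, sq, -⟩ := E.pushout_inflation _ (a.app X) (hf X)
      exact sq.hasPushout
    obtain ⟨Q, b, g, sq, sq'⟩ := exists_isPushout_app f a
    exact ⟨Q, b, g, sq, fun X => E.inflation.of_isPushout (sq' X).flip (hf X)⟩
  pullback_deflation f a := by
    simp only [secondMaps_pointwiseConflation_iff]
    intro hf
    have (X : D) : HasPullback (f.app X) (a.app X) := by
      obtain ⟨_, _, _, sq, -⟩ := E.pullback_deflation _ (a.app X) (hf X)
      exact sq.hasPullback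
    obtain ⟨Q, b, g, sq, sq'⟩ := exists_isPullback_app f a
    exact ⟨Q, b, g, sq, fun X => E.deflation.of_isPullback (sq' X) (hf X)⟩

lemma isConflation_functorCategory_iff {H : D ⥤ C} {i : F ⟶ G} {d : G ⟶ H} :
    (E.functorCategory D).IsConflation i d ↔ ∀ X, E.IsConflation (i.app X) (d.app X) :=
  ⟨fun h X => ⟨NatTrans.congr_app h.w X, h.conflation X⟩,
    fun h => ⟨by ext X; exact (h X).w, fun X => (h X).conflation⟩⟩

end FunctorCategory

section WeaklyIdempotentComplete

lemma deflation_of_comp (hC : IsWeaklyIdempotentComplete C) {W Y Z : C} {p : W ⟶ Y}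
    {g : Y ⟶ Z} (h : E.deflation (p ≫ g)) : E.deflation g := by
  -- The kernel `K` of `(g, p ≫ g) : Y ⊞ W ⟶ Z` contains `W`, embedded by `(-p, 1)`, as a direct
  -- summand; pushing the conflation out along `K ⟶ K / W` leaves one ending in `g`.
  obtain ⟨K, e, he⟩ := deflation_iff.1 (E.deflation_desc g h)
  obtain ⟨k, hk⟩ := he.exists_lift (biprod.lift (-p) (𝟙 W)) (by simp)
  have := hC k ⟨⟨e ≫ biprod.snd, by simp [reassoc_of% hk]⟩⟩
  let c : cokernel k ⟶ Y := cokernel.desc k (e ≫ biprod.desc (𝟙 Y) p) (by simp [reassoc_of% hk])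
  have hc : cokernel.π k ≫ c = e ≫ biprod.desc (𝟙 Y) p := cokernel.π_desc _ _ _
  have hcg : c ≫ g = 0 := by
    have : biprod.desc (𝟙 Y) p ≫ g = biprod.desc g (p ≫ g) := by ext <;> simp
    rw [← cancel_epi (cokernel.π k), reassoc_of% hc, this, he.w, comp_zero]
  have hfac {T : C} {a : Y ⊞ W ⟶ T} {b : cokernel k ⟶ T} (hab : e ≫ a = cokernel.π k ≫ b) :
      biprod.desc (𝟙 Y) p ≫ biprod.inl ≫ a = a := by
    have : biprod.inr ≫ a - p ≫ biprod.inl ≫ a = 0 := by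
      simpa [biprod.lift_eq, hab, sub_eq_neg_add] using (hk =≫ a).symm
    ext
    · simp
    · simpa using (sub_eq_zero.1 this).symm
  have sq : IsPushout e (cokernel.π k) (biprod.desc (𝟙 Y) p) c := by
    refine .of_isColimit' ⟨hc.symm⟩ (PushoutCocone.IsColimit.mk _ (fun t => biprod.inl ≫ t.inl)
      (fun t => hfac t.condition) (fun t => ?_) fun t m h _ => by simp [← h])
    rw [← cancel_epi (cokernel.π k), reassoc_of% hc, hfac t.condition, t.condition]
  exact (he.of_isPushout sq (by ext <;> simp) hcg).deflation

lemma inflation_of_comp (hC : IsWeaklyIdempotentComplete C) {X Y Z : C} {f : X ⟶ Y}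
    {g : Y ⟶ Z} (h : E.inflation (f ≫ g)) : E.inflation f := by
  obtain ⟨_, _, h⟩ := inflation_iff.1 h
  obtain ⟨_, _, h⟩ :=
    deflation_iff.1 (deflation_of_comp hC.op (p := g.op) (g := f.op) h.op.deflation)
  exact h.unop.inflation

lemma inflation_isStableUnderRetracts (hC : IsWeaklyIdempotentComplete C) :
    E.inflation.IsStableUnderRetracts where
  of_retract {_ _ _ _ f g} h hg := by
    have : E.inflation h.i.left := inflation_of_comp hC (g := h.r.left) (by
      rw [h.retract_left]; exact E.inflation.id_mem _)
    refine inflation_of_comp hC (g := h.i.right) ?_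
    rw [← h.i_w]
    exact E.inflation.comp_mem _ _ this hg

lemma deflation_isStableUnderRetracts (hC : IsWeaklyIdempotentComplete C) :
    E.deflation.IsStableUnderRetracts where
  of_retract {_ _ _ _ f g} h hg := by
    have : E.deflation h.r.right := deflation_of_comp hC (p := h.i.right) (by
      rw [h.retract_right]; exact E.deflation.id_mem _)
    refine deflation_of_comp hC (p := h.r.left) ?_
    rw [h.r_w]
    exact E.deflation.comp_mem _ _ hg this

end WeaklyIdempotentComplete

section Ext

lemma IsConflation.exists_retraction {X Y Z : C} {i : X ⟶ Y} {d : Y ⟶ Z}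
    (h : E.IsConflation i d) {s : Z ⟶ Y} (hs : s ≫ d = 𝟙 Z) :
    ∃ r : Y ⟶ X, i ≫ r = 𝟙 X ∧ r ≫ i = 𝟙 Y - d ≫ s := by
  obtain ⟨r, hr⟩ := h.exists_lift (𝟙 Y - d ≫ s) (by simp [hs])
  have := h.mono
  exact ⟨r, by simp [← cancel_mono i, hr, reassoc_of% h.w], hr⟩

lemma IsConflation.exists_section {X Y Z : C} {i : X ⟶ Y} {d : Y ⟶ Z}
    (h : E.IsConflation i d) {r : Y ⟶ X} (hr : i ≫ r = 𝟙 X) :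
    ∃ s : Z ⟶ Y, s ≫ d = 𝟙 Z ∧ d ≫ s = 𝟙 Y - r ≫ i := by
  obtain ⟨s, hs⟩ := h.exists_desc (𝟙 Y - r ≫ i) (by simp [reassoc_of% hr])
  have := h.epi
  exact ⟨s, by simp [← cancel_epi d, reassoc_of% hs, h.w], hs⟩

namespace Extension

variable {A B : C} {ε ε' : E.Extension A B}

lemma isConflation (ε : E.Extension A B) : E.IsConflation ε.i ε.d := ⟨ε.w, ε.conflation⟩

lemma Rel.splits_iff (h : Extension.Rel E ε ε') :
    (∃ s, s ≫ ε.d = 𝟙 A) ↔ ∃ s, s ≫ ε'.d = 𝟙 A := by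
  obtain ⟨φ, hi, hd⟩ := h
  refine ⟨fun ⟨s, hs⟩ => ⟨s ≫ φ, by rw [Category.assoc, hd, hs]⟩, fun ⟨s, hs⟩ => ?_⟩
  obtain ⟨r, hr, -⟩ := ε'.isConflation.exists_retraction hs
  obtain ⟨s', hs', -⟩ := ε.isConflation.exists_section (r := φ ≫ r) (by rw [reassoc_of% hi, hr])
  exact ⟨s', hs'⟩

lemma rel_of_section {s : A ⟶ ε.M} {s' : A ⟶ ε'.M} (hs : s ≫ ε.d = 𝟙 A) (hs' : s' ≫ ε'.d = 𝟙 A) :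
    Extension.Rel E ε ε' := by
  obtain ⟨r, hr, -⟩ := ε.isConflation.exists_retraction hs
  exact ⟨r ≫ ε'.i + ε.d ≫ s', by simp [reassoc_of% hr, reassoc_of% ε.w], by simp [ε'.w, hs']⟩

end Extension

lemma ext1Vanishes_iff_exists_section {A B : C} : E.Ext1Vanishes A B ↔
    ∀ (M : C) (i : B ⟶ M) (d : M ⟶ A), E.IsConflation i d → ∃ s, s ≫ d = 𝟙 A := by
  refine ⟨fun hAB M i d h => ?_, fun h => ⟨fun x y => ?_⟩⟩
  · have h₀ := E.isConflation_inl_snd B A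
    let ε₀ : E.Extension A B := ⟨_, _, _, h₀.w, h₀.conflation⟩
    let ε : E.Extension A B := ⟨M, i, d, h.w, h.conflation⟩
    let splits : E.Ext1 A B → Prop :=
      Quot.lift (fun ε => ∃ s, s ≫ ε.d = 𝟙 A) fun _ _ h => propext h.splits_iff
    have : Subsingleton (E.Ext1 A B) := hAB
    exact (congrArg splits (this.elim (Quot.mk _ ε₀) (Quot.mk _ ε))).mp
      ⟨biprod.inr, biprod.inr_snd⟩
  · induction x using Quot.inductionOn with | h ε => ?_
    induction y using Quot.inductionOn with | h ε' => ?_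
    obtain ⟨s, hs⟩ := h _ _ _ ε.isConflation
    obtain ⟨s', hs'⟩ := h _ _ _ ε'.isConflation
    exact Quot.sound (Extension.rel_of_section hs hs')

lemma Ext1Vanishes.of_iso {A A' B B' : C} (h : E.Ext1Vanishes A B) (a : A ≅ A') (b : B ≅ B') :
    E.Ext1Vanishes A' B' := by
  rw [ext1Vanishes_iff_exists_section] at h ⊢
  intro M i d hid
  obtain ⟨s, hs⟩ := h M (b.hom ≫ i) (d ≫ a.inv)
    (hid.of_iso b.symm (Iso.refl _) a.symm (by simp) (by simp))
  exact ⟨a.inv ≫ s, by simpa using a.inv ≫= hs =≫ a.hom⟩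

instance (S : ObjectProperty C) : (E.leftPerp S).IsClosedUnderIsomorphisms where
  of_iso e h B hB := (h B hB).of_iso e (Iso.refl B)

instance (S : ObjectProperty C) : (E.rightPerp S).IsClosedUnderIsomorphisms where
  of_iso e h A hA := (h A hA).of_iso (Iso.refl A) e

end Ext

section Lifting

lemma Ext1Vanishes.exists_extension {X Y A B : C} (hAB : E.Ext1Vanishes A B) {f : X ⟶ Y}
    {d : Y ⟶ A} (hf : E.IsConflation f d) (a : X ⟶ B) : ∃ b : Y ⟶ B, f ≫ b = a := by
  obtain ⟨M, b, i, d', sq, -, hi⟩ := hf.exists_isPushout a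
  obtain ⟨s, hs⟩ := ext1Vanishes_iff_exists_section.1 hAB M i d' hi
  obtain ⟨r, hr, -⟩ := hi.exists_retraction hs
  exact ⟨b ≫ r, by rw [sq.w_assoc, hr, Category.comp_id]⟩

lemma IsConflation.biprod_desc_comp {X Y A B P : C} {f : X ⟶ Y} {d : Y ⟶ A} {i : B ⟶ P}
    {g : P ⟶ Y} (hf : E.IsConflation f d) (hg : E.IsConflation i g) {u : X ⟶ P}
    (hu : u ≫ g = f) : E.IsConflation (biprod.desc i u) (g ≫ d) := by
  have := hf.mono
  have := hg.mono
  have : Mono (biprod.desc i u) := Preadditive.mono_of_cancel_zero _ fun {T} t ht => by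
    have hsnd : t ≫ biprod.snd = 0 := by
      simpa [← cancel_mono f, biprod.desc_eq, hg.w, hu] using ht =≫ g
    have hfst : t ≫ biprod.fst = 0 := by
      simpa [← cancel_mono i, biprod.desc_eq, reassoc_of% hsnd] using ht
    ext <;> simp [hfst, hsnd]
  have w : biprod.desc i u ≫ g ≫ d = 0 := by
    ext <;> simp [reassoc_of% hg.w, reassoc_of% hu, hf.w]
  refine .of_isLimit (w := w) (E.deflation.comp_mem _ _ hg.deflation hf.deflation)
    (KernelFork.IsLimit.ofι' _ _ fun k hk => Classical.indefiniteDescription _ ?_)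
  obtain ⟨q, hq⟩ := hf.exists_lift (k ≫ g) (by simpa using hk)
  obtain ⟨p, hp⟩ := hg.exists_lift (k - q ≫ u) (by simp [hu, hq])
  exact ⟨biprod.lift p q, by simp [hp]⟩

lemma exists_section_of_ext1Vanishes {X Y A B P : C} {f : X ⟶ Y} {d : Y ⟶ A} {i : B ⟶ P}
    {g : P ⟶ Y} (hf : E.IsConflation f d) (hg : E.IsConflation i g) (hAB : E.Ext1Vanishes A B)
    {u : X ⟶ P} (hu : u ≫ g = f) : ∃ s : Y ⟶ P, s ≫ g = 𝟙 Y ∧ f ≫ s = u := by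
  -- `A` is the cokernel of `(i, u) : B ⊞ X ⟶ P`, so the projection to `B` extends to `P`. The
  -- extension is a retraction of `i` vanishing on `X`, hence its section of `g` restricts to `u`.
  obtain ⟨r, hr⟩ := hAB.exists_extension (hf.biprod_desc_comp hg hu) biprod.fst
  have hir : i ≫ r = 𝟙 B := by simpa using biprod.inl ≫= hr
  have hur : u ≫ r = 0 := by simpa using biprod.inr ≫= hr
  obtain ⟨s, hs, hgs⟩ := hg.exists_section hir
  exact ⟨s, hs, by rw [← hu, Category.assoc, hgs]; simp [reassoc_of% hur]⟩

lemma hasLiftingProperty_of_ext1Vanishes {X Y A B M N : C} {f : X ⟶ Y} {d : Y ⟶ A} {i : B ⟶ M}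
    {g : M ⟶ N} (hf : E.IsConflation f d) (hg : E.IsConflation i g) (hAB : E.Ext1Vanishes A B) :
    HasLiftingProperty f g where
  sq_hasLift {u v} sq := by
    obtain ⟨P, b, g', i', hP, -, hg'⟩ := hg.exists_isPullback v
    obtain ⟨s, hs, hfs⟩ := exists_section_of_ext1Vanishes hf hg' hAB
      (u := hP.lift u f sq.w) (hP.lift_snd _ _ _)
    exact ⟨⟨s ≫ b, by rw [reassoc_of% hfs, hP.lift_fst],
      by rw [Category.assoc, hP.w, reassoc_of% hs]⟩⟩

lemma inflClass_iff {S : ObjectProperty C} {X Y : C} {f : X ⟶ Y} :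
    E.inflClass S f ↔ ∃ (Z : C) (d : Y ⟶ Z), E.IsConflation f d ∧ S Z := by
  simp only [inflClass, IsConflation, exists_and_right]

lemma deflClass_iff {S : ObjectProperty C} {Y Z : C} {f : Y ⟶ Z} :
    E.deflClass S f ↔ ∃ (X : C) (i : X ⟶ Y), E.IsConflation i f ∧ S X := by
  simp only [deflClass, IsConflation, exists_and_right]

variable (E)

lemma inflClass_leftPerp (S : ObjectProperty C) :
    E.inflClass (E.leftPerp S) = E.inflation ⊓ (E.deflClass S).llp := by
  ext X Y f
  rw [inflClass_iff]
  refine ⟨fun ⟨Z, d, hf, hZ⟩ => ⟨hf.inflation, fun _ _ g hg => ?_⟩, fun ⟨hf, hllp⟩ => ?_⟩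
  · obtain ⟨B, i, hg, hB⟩ := deflClass_iff.1 hg
    exact hasLiftingProperty_of_ext1Vanishes hf hg (hZ B hB)
  · obtain ⟨Z, d, hf⟩ := inflation_iff.1 hf
    refine ⟨Z, d, hf, fun B hB => ext1Vanishes_iff_exists_section.2 fun M i g hg => ?_⟩
    have := hllp g (deflClass_iff.2 ⟨B, i, hg, hB⟩)
    have sq : CommSq (0 : X ⟶ M) f g d := ⟨by simp [hf.w]⟩
    obtain ⟨s, hs⟩ := hf.exists_desc sq.lift sq.fac_left
    have := hf.epi
    exact ⟨s, by rw [← cancel_epi d, reassoc_of% hs, sq.fac_right, Category.comp_id]⟩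

lemma deflClass_rightPerp (S : ObjectProperty C) :
    E.deflClass (E.rightPerp S) = E.deflation ⊓ (E.inflClass S).rlp := by
  ext Y Z g
  rw [deflClass_iff]
  refine ⟨fun ⟨X, i, hg, hX⟩ => ⟨hg.deflation, fun _ _ f hf => ?_⟩, fun ⟨hg, hrlp⟩ => ?_⟩
  · obtain ⟨A, d, hf, hA⟩ := inflClass_iff.1 hf
    exact hasLiftingProperty_of_ext1Vanishes hf hg (hX A hA)
  · obtain ⟨X, i, hg⟩ := deflation_iff.1 hg
    refine ⟨X, i, hg, fun A hA => ext1Vanishes_iff_exists_section.2 fun M f d hf => ?_⟩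
    have := hrlp f (inflClass_iff.2 ⟨A, d, hf, hA⟩)
    have sq : CommSq i f g (0 : M ⟶ Z) := ⟨by simp [hg.w]⟩
    obtain ⟨r, hr⟩ := hg.exists_lift sq.lift sq.fac_right
    have := hg.mono
    obtain ⟨s, hs, -⟩ := hf.exists_section (r := r)
      (by rw [← cancel_mono i, Category.assoc, hr, sq.fac_left, Category.id_comp])
    exact ⟨s, hs⟩

end Lifting

section Classes

lemma IsConflation.inflClass_iff {S : ObjectProperty C} [S.IsClosedUnderIsomorphisms]
    {X Y Z : C} {f : X ⟶ Y} {d : Y ⟶ Z} (h : E.IsConflation f d) : E.inflClass S f ↔ S Z := by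
  rw [ExactStructure.inflClass_iff]
  refine ⟨fun ⟨Z', d', h', hZ'⟩ => ?_, fun hZ => ⟨Z, d, h, hZ⟩⟩
  obtain ⟨hd⟩ := h.isColimit
  obtain ⟨hd'⟩ := h'.isColimit
  exact S.prop_of_iso (hd'.coconePointUniqueUpToIso hd) hZ'

lemma IsConflation.deflClass_iff {S : ObjectProperty C} [S.IsClosedUnderIsomorphisms]
    {X Y Z : C} {i : X ⟶ Y} {f : Y ⟶ Z} (h : E.IsConflation i f) : E.deflClass S f ↔ S X := by
  rw [ExactStructure.deflClass_iff]
  refine ⟨fun ⟨X', i', h', hX'⟩ => ?_, fun hX => ⟨X, i, h, hX⟩⟩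
  obtain ⟨hi⟩ := h.isLimit
  obtain ⟨hi'⟩ := h'.isLimit
  exact S.prop_of_iso (hi'.conePointUniqueUpToIso hi) hX'

lemma inflClass_iff_of_zero {S : ObjectProperty C} [S.IsClosedUnderIsomorphisms] {X : C}
    (f : (0 : C) ⟶ X) : E.inflClass S f ↔ S X := by
  rw [(isZero_zero C).eq_of_src f 0, (E.isConflation_zero_id X).inflClass_iff]

lemma deflClass_iff_to_zero {S : ObjectProperty C} [S.IsClosedUnderIsomorphisms] {X : C}
    (f : X ⟶ (0 : C)) : E.deflClass S f ↔ S X := by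
  rw [(isZero_zero C).eq_of_tgt f 0, (E.isConflation_id_zero X).deflClass_iff]

instance (L : MorphismProperty C) : (E.cokerClass L).IsClosedUnderIsomorphisms where
  of_iso := fun e ⟨X, Y, Z, f, d, w, hf, h, ⟨e'⟩⟩ => ⟨X, Y, Z, f, d, w, hf, h, ⟨e.symm ≪≫ e'⟩⟩

instance (R : MorphismProperty C) : (E.kerClass R).IsClosedUnderIsomorphisms where
  of_iso := fun e ⟨X, Y, Z, i, f, w, hf, h, ⟨e'⟩⟩ => ⟨X, Y, Z, i, f, w, hf, h, ⟨e.symm ≪≫ e'⟩⟩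

variable (E) (S : ObjectProperty C) [S.IsClosedUnderIsomorphisms]

lemma cokerClass_inflClass : E.cokerClass (E.inflClass S) = S := by
  ext Z
  refine ⟨fun ⟨_, _, _, f, d, w, hf, h, ⟨e⟩⟩ => ?_, fun hZ => ?_⟩
  · exact S.prop_of_iso e.symm ((IsConflation.inflClass_iff ⟨w, h⟩).1 hf)
  · obtain ⟨w, h⟩ := E.isConflation_zero_id Z
    exact ⟨_, _, _, _, _, w, (inflClass_iff_of_zero _).2 hZ, h, ⟨Iso.refl Z⟩⟩

lemma kerClass_deflClass : E.kerClass (E.deflClass S) = S := by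
  ext X
  refine ⟨fun ⟨_, _, _, i, f, w, hf, h, ⟨e⟩⟩ => ?_, fun hX => ?_⟩
  · exact S.prop_of_iso e.symm ((IsConflation.deflClass_iff ⟨w, h⟩).1 hf)
  · obtain ⟨w, h⟩ := E.isConflation_id_zero X
    exact ⟨_, _, _, _, _, w, (deflClass_iff_to_zero _).2 hX, h, ⟨Iso.refl X⟩⟩

end Classes

section ZeroObject

/-- The objects which are cofibrant for `L`, the left class of a weak factorization system. -/
def cofibrantObjects (L : MorphismProperty C) : ObjectProperty C :=
  fun X => L (0 : (0 : C) ⟶ X)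

/-- The objects which are fibrant for `R`, the right class of a weak factorization system. -/
def fibrantObjects (R : MorphismProperty C) : ObjectProperty C :=
  fun X => R (0 : X ⟶ (0 : C))

instance (L : MorphismProperty C) [L.RespectsIso] :
    (cofibrantObjects L).IsClosedUnderIsomorphisms where
  of_iso e h := by
    simpa using! (L.cancel_right_of_respectsIso _ e.hom).2 h

instance (R : MorphismProperty C) [R.RespectsIso] :
    (fibrantObjects R).IsClosedUnderIsomorphisms where
  of_iso e h := by
    simpa using! (R.cancel_left_of_respectsIso e.inv _).2 h

end ZeroObject

namespace IsExactWFS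

variable {L R : MorphismProperty C}

lemma inflClass_cofibrantObjects (h : E.IsExactWFS L R) :
    E.inflClass (cofibrantObjects L) = L := by
  ext X Y f
  exact (h.left_iff f).symm

lemma deflClass_fibrantObjects (h : E.IsExactWFS L R) :
    E.deflClass (fibrantObjects R) = R := by
  ext X Y f
  exact (h.right_iff f).symm

lemma cokerClass_eq (h : E.IsExactWFS L R) : E.cokerClass L = cofibrantObjects L := by
  have := h.retract_left
  rw [← E.cokerClass_inflClass (cofibrantObjects L), h.inflClass_cofibrantObjects]

lemma kerClass_eq (h : E.IsExactWFS L R) : E.kerClass R = fibrantObjects R := by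
  have := h.retract_right
  rw [← E.kerClass_deflClass (fibrantObjects R), h.deflClass_fibrantObjects]

lemma inflClass_cokerClass (h : E.IsExactWFS L R) : E.inflClass (E.cokerClass L) = L := by
  rw [h.cokerClass_eq, h.inflClass_cofibrantObjects]

lemma deflClass_kerClass (h : E.IsExactWFS L R) : E.deflClass (E.kerClass R) = R := by
  rw [h.kerClass_eq, h.deflClass_fibrantObjects]

end IsExactWFS

section OfFactorization

variable {A B : ObjectProperty C}

lemma leftPerp_eq_of_isWFS [A.IsClosedUnderIsomorphisms]
    (h : IsWFS (E.inflClass A) (E.deflClass B)) : E.leftPerp B = A := by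
  have hinfl : E.inflClass A ≤ E.inflation := fun _ _ _ ⟨Z, d, w, hd, _⟩ => ⟨Z, d, w, hd⟩
  have : E.inflClass (E.leftPerp B) = E.inflClass A := by
    rw [inflClass_leftPerp, ((isWFS_iff _ _).1 h).llp, inf_eq_right.2 hinfl]
  rw [← E.cokerClass_inflClass (E.leftPerp B), this, E.cokerClass_inflClass]

lemma rightPerp_eq_of_isWFS [B.IsClosedUnderIsomorphisms]
    (h : IsWFS (E.inflClass A) (E.deflClass B)) : E.rightPerp A = B := by
  have hdefl : E.deflClass B ≤ E.deflation := fun _ _ _ ⟨X, i, w, hi, _⟩ => ⟨X, i, w, hi⟩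
  have : E.deflClass (E.rightPerp A) = E.deflClass B := by
    rw [deflClass_rightPerp, ((isWFS_iff _ _).1 h).rlp, inf_eq_right.2 hdefl]
  rw [← E.kerClass_deflClass (E.rightPerp A), this, E.kerClass_deflClass]

variable [A.IsClosedUnderIsomorphisms] [B.IsClosedUnderIsomorphisms]

lemma isCompleteCotorsionPair_of_isWFS (h : IsWFS (E.inflClass A) (E.deflClass B)) :
    E.IsCompleteCotorsionPair A B where
  left_eq := (leftPerp_eq_of_isWFS h).symm
  right_eq := rightPerp_eq_of_isWFS h
  approx_right X := by
    obtain ⟨M, i, p, -, ⟨Z, d, w, hid, hZ⟩, hp⟩ :=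
      (h.factorization.nonempty_mapFactorizationData (0 : X ⟶ (0 : C))).some
    exact ⟨M, Z, i, d, w, hid, hZ, (deflClass_iff_to_zero p).1 hp⟩
  approx_left X := by
    obtain ⟨M, i, p, -, hi, ⟨K, k, w, hkp, hK⟩⟩ :=
      (h.factorization.nonempty_mapFactorizationData (0 : (0 : C) ⟶ X)).some
    exact ⟨K, M, k, p, w, hkp, (inflClass_iff_of_zero i).1 hi, hK⟩

lemma exists_functorial_right_of_hasFunctorialFactorization
    (h : (E.inflClass A).HasFunctorialFactorization (E.deflClass B)) :
    ∃ (FB FA : C ⥤ C) (i : 𝟭 C ⟶ FB) (d : FB ⟶ FA), ∀ X : C,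
      E.IsConflation (i.app X) (d.app X) ∧ A (FA.obj X) ∧ B (FB.obj X) := by
  obtain ⟨⟨Z, i, p, -, hi, hp⟩⟩ := h
  let T : C ⥤ Arrow C :=
    { obj X := Arrow.mk (0 : X ⟶ (0 : C))
      map f := Arrow.homMk f (𝟙 _) (by simp) }
  let j : 𝟭 C ⟶ T ⋙ Z := Functor.whiskerLeft T i
  have hj (X : C) : E.inflClass A (j.app X) := hi (T.obj X)
  obtain ⟨Q, q, hq⟩ := exists_isConflation_app_of_inflation (E := E) (f := j) fun X => by
    obtain ⟨_, _, w, h, -⟩ := hj X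
    exact ⟨_, _, w, h⟩
  exact ⟨T ⋙ Z, Q, j, q, fun X => ⟨hq X, (hq X).inflClass_iff.1 (hj X),
    (deflClass_iff_to_zero _).1 (hp (T.obj X))⟩⟩

lemma exists_functorial_left_of_hasFunctorialFactorization
    (h : (E.inflClass A).HasFunctorialFactorization (E.deflClass B)) :
    ∃ (FB FA : C ⥤ C) (i : FB ⟶ FA) (d : FA ⟶ 𝟭 C), ∀ X : C,
      E.IsConflation (i.app X) (d.app X) ∧ A (FA.obj X) ∧ B (FB.obj X) := by
  obtain ⟨⟨Z, i, p, -, hi, hp⟩⟩ := h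
  let T : C ⥤ Arrow C :=
    { obj X := Arrow.mk (0 : (0 : C) ⟶ X)
      map f := Arrow.homMk (𝟙 _) f (by simp) }
  let q : T ⋙ Z ⟶ 𝟭 C := Functor.whiskerLeft T p
  have hq (X : C) : E.deflClass B (q.app X) := hp (T.obj X)
  obtain ⟨K, k, hk⟩ := exists_isConflation_app_of_deflation (E := E) (f := q) fun X => by
    obtain ⟨_, _, w, h, -⟩ := hq X
    exact ⟨_, _, w, h⟩
  exact ⟨K, T ⋙ Z, k, q, fun X => ⟨hk X, (inflClass_iff_of_zero _).1 (hi (T.obj X)),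
    (hk X).deflClass_iff.1 (hq X)⟩⟩

lemma isFunctoriallyCompleteCotorsionPair_of_isWFS (h : IsWFS (E.inflClass A) (E.deflClass B))
    (h' : (E.inflClass A).HasFunctorialFactorization (E.deflClass B)) :
    E.IsFunctoriallyCompleteCotorsionPair A B where
  toIsCompleteCotorsionPair := isCompleteCotorsionPair_of_isWFS h
  functorial_right := by
    obtain ⟨FB, FA, i, d, hid⟩ := exists_functorial_right_of_hasFunctorialFactorization h'
    exact ⟨FB, FA, i, d, fun X => (hid X).1.w, fun X => ⟨(hid X).1.conflation, (hid X).2⟩⟩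
  functorial_left := by
    obtain ⟨FB, FA, i, d, hid⟩ := exists_functorial_left_of_hasFunctorialFactorization h'
    exact ⟨FB, FA, i, d, fun X => (hid X).1.w, fun X => ⟨(hid X).1.conflation, (hid X).2⟩⟩

lemma IsExactWFS.isCompleteCotorsionPair {L R : MorphismProperty C} (h : E.IsExactWFS L R) :
    E.IsCompleteCotorsionPair (E.cokerClass L) (E.kerClass R) :=
  isCompleteCotorsionPair_of_isWFS
    (by simpa only [h.inflClass_cokerClass, h.deflClass_kerClass] using h.toIsWFS)

lemma IsExactFunctorialWFS.isFunctoriallyCompleteCotorsionPair {L R : MorphismProperty C}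
    (h : E.IsExactFunctorialWFS L R) :
    E.IsFunctoriallyCompleteCotorsionPair (E.cokerClass L) (E.kerClass R) :=
  isFunctoriallyCompleteCotorsionPair_of_isWFS
    (by simpa only [h.inflClass_cokerClass, h.deflClass_kerClass] using h.toIsWFS)
    (by simpa only [h.inflClass_cokerClass, h.deflClass_kerClass] using h.functorial)

end OfFactorization

section Factorization

variable {A B : ObjectProperty C}

lemma exists_factorization {X Y B₁ A₁ : C} (f : X ⟶ Y) {b : B₁ ⟶ A₁} {a : A₁ ⟶ Y}
    (hba : E.IsConflation b a) (hA₁ : A A₁)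
    (approx : ∀ K : C, ∃ (B₂ A₂ : C) (i : K ⟶ B₂) (d : B₂ ⟶ A₂),
      E.IsConflation i d ∧ A A₂ ∧ B B₂) :
    ∃ (P Q : C) (s : X ⟶ P) (t : P ⟶ Q) (p : Q ⟶ Y),
      s ≫ t ≫ p = f ∧ E.inflClass A s ∧ E.inflClass A t ∧ E.deflClass B p := by
  obtain ⟨K, k, hk⟩ := deflation_iff.1 (E.deflation_desc f hba.deflation)
  obtain ⟨B₂, A₂, i, d, hid, hA₂, hB₂⟩ := approx K
  obtain ⟨Q, t, j, p, sq, htp, hjp⟩ := hk.exists_isPushout i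
  have ht : E.IsConflation t (sq.desc 0 d (by simp [hid.w])) :=
    hid.of_isPushout sq.flip (by simp) (by simp)
  exact ⟨X ⊞ A₁, Q, biprod.inl, t, p, by simp [htp],
    inflClass_iff.2 ⟨A₁, _, E.isConflation_inl_snd X A₁, hA₁⟩, inflClass_iff.2 ⟨A₂, _, ht, hA₂⟩,
    deflClass_iff.2 ⟨B₂, j, hjp, hB₂⟩⟩

namespace IsCompleteCotorsionPair

lemma inflClass_eq (h : E.IsCompleteCotorsionPair A B) :
    E.inflClass A = E.inflation ⊓ (E.deflClass B).llp := by
  rw [← inflClass_leftPerp, ← h.left_eq]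

lemma deflClass_eq (h : E.IsCompleteCotorsionPair A B) :
    E.deflClass B = E.deflation ⊓ (E.inflClass A).rlp := by
  rw [← deflClass_rightPerp, h.right_eq]

lemma isMultiplicative_inflClass (h : E.IsCompleteCotorsionPair A B) :
    (E.inflClass A).IsMultiplicative := by
  rw [h.inflClass_eq]
  infer_instance

lemma isClosedUnderIsomorphisms_left (h : E.IsCompleteCotorsionPair A B) :
    A.IsClosedUnderIsomorphisms :=
  h.left_eq ▸ inferInstance

lemma isClosedUnderIsomorphisms_right (h : E.IsCompleteCotorsionPair A B) :
    B.IsClosedUnderIsomorphisms :=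
  h.right_eq ▸ inferInstance

lemma hasFactorization (h : E.IsCompleteCotorsionPair A B) :
    (E.inflClass A).HasFactorization (E.deflClass B) where
  nonempty_mapFactorizationData {X Y} f := by
    obtain ⟨B₁, A₁, b, a, w, hba, hA₁, -⟩ := h.approx_left Y
    obtain ⟨P, Q, s, t, p, hf, hs, ht, hp⟩ := exists_factorization f ⟨w, hba⟩ hA₁ fun K => by
      obtain ⟨B₂, A₂, i, d, w, hid, h⟩ := h.approx_right K
      exact ⟨B₂, A₂, i, d, ⟨w, hid⟩, h⟩
    have := h.isMultiplicative_inflClass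
    exact ⟨⟨Q, s ≫ t, p, by simp [hf], (E.inflClass A).comp_mem _ _ hs ht, hp⟩⟩

lemma isExactWFS (hC : IsWeaklyIdempotentComplete C) (h : E.IsCompleteCotorsionPair A B) :
    E.IsExactWFS (E.inflClass A) (E.deflClass B) where
  retract_left := by
    have := inflation_isStableUnderRetracts (E := E) hC
    rw [h.inflClass_eq]
    infer_instance
  retract_right := by
    have := deflation_isStableUnderRetracts (E := E) hC
    rw [h.deflClass_eq]
    infer_instance
  lifting f g hf hg := (h.inflClass_eq.le f hf).2 g hg
  factorization := h.hasFactorization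
  left_iff f := by
    have := h.isClosedUnderIsomorphisms_left
    simp only [inflClass_iff_of_zero]
    rfl
  right_iff f := by
    have := h.isClosedUnderIsomorphisms_right
    simp only [deflClass_iff_to_zero]
    rfl

end IsCompleteCotorsionPair

lemma IsFunctoriallyCompleteCotorsionPair.hasFunctorialFactorization
    (h : E.IsFunctoriallyCompleteCotorsionPair A B) :
    (E.inflClass A).HasFunctorialFactorization (E.deflClass B) := by
  obtain ⟨FB₁, FA₁, b, a, w₁, h₁⟩ := h.functorial_left
  obtain ⟨FB₂, FA₂, i, d, w₂, h₂⟩ := h.functorial_right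
  let b' : Arrow.rightFunc ⋙ FB₁ ⟶ Arrow.rightFunc ⋙ FA₁ := Functor.whiskerLeft _ b
  let a' : Arrow.rightFunc ⋙ FA₁ ⟶ Arrow.rightFunc := Functor.whiskerLeft Arrow.rightFunc a
  have hba : (E.functorCategory (Arrow C)).IsConflation b' a' :=
    isConflation_functorCategory_iff.2 fun f => ⟨w₁ f.right, (h₁ f.right).1⟩
  obtain ⟨P, Q, s, t, p, hf, hs, ht, hp⟩ :=
    exists_factorization (E := E.functorCategory (Arrow C)) (A := fun F => ∀ f, A (F.obj f))
      (B := fun F => ∀ f, B (F.obj f)) (Arrow.leftToRight (C := C)) hba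
      (fun f => (h₁ f.right).2.1) fun K =>
        ⟨K ⋙ FB₂, K ⋙ FA₂, Functor.whiskerLeft K i, Functor.whiskerLeft K d,
          isConflation_functorCategory_iff.2 fun f => ⟨w₂ _, (h₂ (K.obj f)).1⟩,
          fun f => (h₂ (K.obj f)).2.1, fun f => (h₂ (K.obj f)).2.2⟩
  have := h.isMultiplicative_inflClass
  obtain ⟨_, _, _, hs, hs'⟩ := hs
  obtain ⟨_, _, _, ht, ht'⟩ := ht
  obtain ⟨_, _, _, hp, hp'⟩ := hp
  exact ⟨⟨Q, s ≫ t, p, by rw [Category.assoc, hf],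
    fun f => (E.inflClass A).comp_mem _ _ ⟨_, _, _, hs f, hs' f⟩ ⟨_, _, _, ht f, ht' f⟩,
    fun f => ⟨_, _, _, hp f, hp' f⟩⟩⟩

end Factorization

end ExactStructure

end QuillenExact

theorem mainTheorem6 {C : Type u} [Category.{v} C] [Preadditive C] [HasFiniteBiproducts C]
    (E : QuillenExact.ExactStructure C) :
    -- over an arbitrary exact category
    (Set.MapsTo E.cokerKer E.exactWFS E.completeCotorsionPairs ∧
      Set.MapsTo E.cokerKer E.exactFunctorialWFS E.functoriallyCompleteCotorsionPairs ∧
      Set.LeftInvOn E.inflDefl E.cokerKer E.exactWFS ∧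
      Set.RightInvOn E.inflDefl E.cokerKer E.completeCotorsionPairs) ∧
    -- over a weakly idempotent complete exact category
    (QuillenExact.IsWeaklyIdempotentComplete C →
      (Set.BijOn E.cokerKer E.exactWFS E.completeCotorsionPairs ∧
        Set.BijOn E.inflDefl E.completeCotorsionPairs E.exactWFS ∧
        Set.InvOn E.inflDefl E.cokerKer E.exactWFS E.completeCotorsionPairs) ∧
      (Set.BijOn E.cokerKer E.exactFunctorialWFS E.functoriallyCompleteCotorsionPairs ∧
        Set.BijOn E.inflDefl E.functoriallyCompleteCotorsionPairs E.exactFunctorialWFS ∧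
        Set.InvOn E.inflDefl E.cokerKer
          E.exactFunctorialWFS E.functoriallyCompleteCotorsionPairs)) := by
  have mapsTo_Φ : Set.MapsTo E.cokerKer E.exactWFS E.completeCotorsionPairs :=
    fun _ hp => hp.isCompleteCotorsionPair
  have mapsTo_Φ' : Set.MapsTo E.cokerKer E.exactFunctorialWFS
      E.functoriallyCompleteCotorsionPairs :=
    fun _ hp => hp.isFunctoriallyCompleteCotorsionPair
  have leftInv : Set.LeftInvOn E.inflDefl E.cokerKer E.exactWFS :=
    fun _ hp => Prod.ext hp.inflClass_cokerClass hp.deflClass_kerClass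
  have rightInv : Set.RightInvOn E.inflDefl E.cokerKer E.completeCotorsionPairs := fun _ hp =>
    have := hp.isClosedUnderIsomorphisms_left
    have := hp.isClosedUnderIsomorphisms_right
    Prod.ext (E.cokerClass_inflClass _) (E.kerClass_deflClass _)
  refine ⟨⟨mapsTo_Φ, mapsTo_Φ', leftInv, rightInv⟩, fun hC => ?_⟩
  have mapsTo_Ψ : Set.MapsTo E.inflDefl E.completeCotorsionPairs E.exactWFS :=
    fun _ hp => hp.isExactWFS hC
  have mapsTo_Ψ' : Set.MapsTo E.inflDefl E.functoriallyCompleteCotorsionPairs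
      E.exactFunctorialWFS :=
    fun _ hp => ⟨hp.isExactWFS hC, hp.hasFunctorialFactorization⟩
  have inv : Set.InvOn E.inflDefl E.cokerKer E.exactWFS E.completeCotorsionPairs :=
    ⟨leftInv, rightInv⟩
  have inv' : Set.InvOn E.inflDefl E.cokerKer E.exactFunctorialWFS
      E.functoriallyCompleteCotorsionPairs :=
    inv.mono (fun _ hp => hp.toIsExactWFS) (fun _ hp => hp.toIsCompleteCotorsionPair)
  exact ⟨⟨inv.bijOn mapsTo_Φ mapsTo_Ψ, inv.symm.bijOn mapsTo_Ψ mapsTo_Φ, inv⟩,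
    ⟨inv'.bijOn mapsTo_Φ' mapsTo_Ψ', inv'.symm.bijOn mapsTo_Ψ' mapsTo_Φ', inv'⟩⟩
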